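/- An oriented matroid $\mathcal M=(E,\mathcal C)$ on a finite ground set $E$ is given by its set $\mathcal C\subseteq\{+,-,0\}^E$ of signed circuits, and is assumed to be simple, i.e. every circuit has at least three nonzero entries. Its rank is the size of a largest subset of $E$ that contains no circuit (i.e. the support of no circuit). For $R\subseteq E$ let ${}_{-R}\mathcal M$ be the oriented matroid obtained by reversing the sign of $X_e$ for all $X\in\mathcal C$ and $e\in R$. For an integer $k\ge 0$, $\mathcal M$ is $k$-neighborly if every circuit of $\mathcal M$ has more than $k$ positive and more than $k$ negative entries, and a set $R\subseteq E$ is a $k$-neighborly reorientation of $\mathcal M$ if ${}_{-R}\mathcal M$ is $k$-neighborly. Let $f(r,n,k)$ be the maximum number of $k$-neighborly reorientations $R\subseteq E$ over all simple oriented matroids of rank $r$ on $n$ elements. Then for all integers $k,r,n$ with $r\ge 2k+2\ge 4$ and $n\ge r+1$, $$f(r,n,k)\le F(r,n,k),\qquad F(r,n,k)=\frac{2\left((n-r)+\binom{r}{k+1}+2^{r-1}\right)^{r-1-2k}}{(r-1-2k)!}.$$ -/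

import Mathlib

/-- An oriented matroid on the ground set `E`, given by its signed circuits
(sign vectors `X : E → SignType`, i.e. with values in `{1, 0, -1}`). -/
structure OrientedMatroid (E : Type*) where
  /-- The set of signed circuits. -/
  circuits : Set (E → SignType)
  /-- The zero vector is not a circuit. -/
  zero_notMem : (0 : E → SignType) ∉ circuits
  /-- The negative of a circuit is a circuit. -/
  neg_mem : ∀ X ∈ circuits, -X ∈ circuits
  /-- Incomparability: nested supports force equality up to sign. -/
  eq_or_eq_neg : ∀ X ∈ circuits, ∀ Y ∈ circuits,
    (∀ e, X e ≠ 0 → Y e ≠ 0) → X = Y ∨ X = -Y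
  /-- Weak circuit elimination: an element `e` with opposite signs in `X ≠ -Y` can be eliminated by
  a circuit `Z` with `Z⁺ ⊆ (X⁺ ∪ Y⁺) \ {e}` and `Z⁻ ⊆ (X⁻ ∪ Y⁻) \ {e}`. -/
  elimination : ∀ X ∈ circuits, ∀ Y ∈ circuits, X ≠ -Y → ∀ e, X e = 1 → Y e = -1 →
    ∃ Z ∈ circuits, Z e = 0 ∧
      ∀ f, (Z f = 1 → X f = 1 ∨ Y f = 1) ∧ (Z f = -1 → X f = -1 ∨ Y f = -1)

namespace OrientedMatroid

/-- The sign vector obtained from `X` by reversing the signs of the elements of `R`. -/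
def signFlip {E : Type*} [DecidableEq E] (R : Finset E) (X : E → SignType) : E → SignType :=
  fun e => if e ∈ R then -X e else X e

theorem signFlip_signFlip {E : Type*} [DecidableEq E] (R : Finset E) (X : E → SignType) :
    signFlip R (signFlip R X) = X := by
  funext e
  by_cases h : e ∈ R <;> simp [signFlip, h]

theorem signFlip_neg {E : Type*} [DecidableEq E] (R : Finset E) (X : E → SignType) :
    signFlip R (-X) = -signFlip R X := by
  funext e
  by_cases h : e ∈ R <;> simp [signFlip, h]

theorem signFlip_zero {E : Type*} [DecidableEq E] (R : Finset E) :
    signFlip R (0 : E → SignType) = 0 := by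
  funext e
  simp [signFlip]

theorem signFlip_apply_ne_zero {E : Type*} [DecidableEq E] (R : Finset E) (X : E → SignType) (e : E) :
    signFlip R X e ≠ 0 ↔ X e ≠ 0 := by
  by_cases h : e ∈ R
  · simp only [signFlip, h, if_true]
    generalize X e = s
    revert s; decide
  · simp [signFlip, h]

/-- The reorientation of `R`: the sign of `X e` is reversed for every circuit `X` and every
`e ∈ R`. -/
def reorient {E : Type*} [DecidableEq E] (M : OrientedMatroid E) (R : Finset E) :
    OrientedMatroid E where
  circuits := signFlip R '' M.circuits
  zero_notMem := by
    rintro ⟨X, hX, h⟩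
    have h0 : X = 0 := by rw [← signFlip_signFlip R X, h, signFlip_zero]
    exact M.zero_notMem (h0 ▸ hX)
  neg_mem := by
    rintro _ ⟨X, hX, rfl⟩
    exact ⟨-X, M.neg_mem X hX, signFlip_neg R X⟩
  eq_or_eq_neg := by
    rintro _ ⟨X, hX, rfl⟩ _ ⟨Y, hY, rfl⟩ h
    rcases M.eq_or_eq_neg X hX Y hY
      (fun e he => (signFlip_apply_ne_zero R Y e).1 (h e ((signFlip_apply_ne_zero R X e).2 he)))
      with h' | h'
    · exact Or.inl (by rw [h'])
    · exact Or.inr (by rw [h', signFlip_neg])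
  elimination := by
    rintro _ ⟨X, hX, rfl⟩ _ ⟨Y, hY, rfl⟩ hne e hXe hYe
    have hne' : X ≠ -Y := fun h => hne (by rw [h, signFlip_neg])
    by_cases he : e ∈ R
    · have hX1 : X e = -1 := by
        simp only [signFlip, he, if_true] at hXe
        rw [← neg_neg (X e), hXe]
      have hY1 : Y e = 1 := by
        simp only [signFlip, he, if_true] at hYe
        exact neg_injective hYe
      obtain ⟨Z, hZ, hZe, hZf⟩ := M.elimination Y hY X hX
        (fun h => hne' (by rw [h, neg_neg])) e hY1 hX1
      refine ⟨signFlip R Z, ⟨Z, hZ, rfl⟩, by simp [signFlip, hZe], fun f => ?_⟩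
      have := hZf f
      by_cases hf : f ∈ R
      · simp only [signFlip, hf, if_true]
        revert this
        generalize X f = a; generalize Y f = b; generalize Z f = c
        revert a b c; decide
      · simp only [signFlip, hf, if_false]
        exact ⟨fun h => (this.1 h).symm, fun h => (this.2 h).symm⟩
    · have hX1 : X e = 1 := by simpa [signFlip, he] using hXe
      have hY1 : Y e = -1 := by simpa [signFlip, he] using hYe
      obtain ⟨Z, hZ, hZe, hZf⟩ := M.elimination X hX Y hY hne' e hX1 hY1
      refine ⟨signFlip R Z, ⟨Z, hZ, rfl⟩, by simp [signFlip, hZe], fun f => ?_⟩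
      have := hZf f
      by_cases hf : f ∈ R
      · simp only [signFlip, hf, if_true]
        revert this
        generalize X f = a; generalize Y f = b; generalize Z f = c
        revert a b c; decide
      · simpa only [signFlip, hf, if_false] using this

/-- The positive elements `X⁺` of a sign vector. -/
def posSet {E : Type*} [Fintype E] (X : E → SignType) : Finset E :=
  Finset.univ.filter (fun e => X e = 1)

/-- The negative elements `X⁻` of a sign vector. -/
def negSet {E : Type*} [Fintype E] (X : E → SignType) : Finset E :=
  Finset.univ.filter (fun e => X e = -1)

/-- The support of a sign vector. -/
def supp {E : Type*} [Fintype E] (X : E → SignType) : Finset E :=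
  Finset.univ.filter (fun e => X e ≠ 0)

/-- `M` is simple if all its circuits have size at least three. -/
def IsSimple {E : Type*} [Fintype E] (M : OrientedMatroid E) : Prop :=
  ∀ X ∈ M.circuits, 3 ≤ (supp X).card

/-- `S` is independent if it contains no circuit (i.e. the support of none). -/
def Indep {E : Type*} [Fintype E] (M : OrientedMatroid E) (S : Finset E) : Prop :=
  ∀ X ∈ M.circuits, ¬ supp X ⊆ S

/-- The rank: the size of a largest set not containing a circuit. -/
noncomputable def rank {E : Type*} [Fintype E] (M : OrientedMatroid E) : ℕ :=
  sSup {m : ℕ | ∃ S : Finset E, M.Indep S ∧ S.card = m}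

/-- The supremum in the definition of the rank is a maximum. -/
theorem isGreatest_rank {E : Type*} [Fintype E] (M : OrientedMatroid E) :
    IsGreatest {m : ℕ | ∃ S : Finset E, M.Indep S ∧ S.card = m} M.rank := by
  have hb : BddAbove {m : ℕ | ∃ S : Finset E, M.Indep S ∧ S.card = m} := by
    refine ⟨Fintype.card E, ?_⟩
    rintro _ ⟨S, -, rfl⟩
    exact Finset.card_le_univ S
  refine ⟨Nat.sSup_mem ⟨0, ∅, fun X hX h => M.zero_notMem ?_, rfl⟩ hb, fun m hm => le_csSup hb hm⟩
  have h0 : X = 0 := by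
    funext e
    by_contra he
    exact absurd (h (Finset.mem_filter.2 ⟨Finset.mem_univ e, he⟩)) (Finset.notMem_empty e)
  exact h0 ▸ hX

/-- `M` is `k`-neighborly if every circuit has more than `k` positive and more than `k` negative
elements. -/
def IsNeighborly {E : Type*} [Fintype E] (M : OrientedMatroid E) (k : ℕ) : Prop :=
  ∀ X ∈ M.circuits, k < (posSet X).card ∧ k < (negSet X).card

/-- The number of `k`-neighborly reorientations of `M`, i.e. of subsets `R` of the ground set such
that the reorientation of `R` is `k`-neighborly. -/
noncomputable def numNeighborlyReorientations {E : Type*} [Fintype E] [DecidableEq E]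
    (M : OrientedMatroid E) (k : ℕ) : ℕ :=
  Set.ncard {R : Finset E | (M.reorient R).IsNeighborly k}

/-- The maximum number `f(r, n, k)` of `k`-neighborly reorientations over all (simple) oriented
matroids of rank `r` on `n` elements. -/
noncomputable def maxNeighborlyReorientations (r n k : ℕ) : ℕ :=
  sSup {m : ℕ | ∃ M : OrientedMatroid (Fin n),
    M.IsSimple ∧ M.rank = r ∧ M.numNeighborlyReorientations k = m}

theorem bddAbove_numNeighborlyReorientations (r n k : ℕ) :
    BddAbove {m : ℕ | ∃ M : OrientedMatroid (Fin n),
      M.IsSimple ∧ M.rank = r ∧ M.numNeighborlyReorientations k = m} := by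
  refine ⟨Fintype.card (Finset (Fin n)), ?_⟩
  rintro _ ⟨M, -, -, rfl⟩
  rw [← Nat.card_eq_fintype_card, ← Set.ncard_univ]
  exact Set.ncard_le_ncard (Set.subset_univ _) Set.finite_univ

/-- The supremum in the definition of `f(r, n, k)` is an upper bound. -/
theorem le_maxNeighborlyReorientations {n : ℕ} (M : OrientedMatroid (Fin n)) (hM : M.IsSimple)
    (k : ℕ) : M.numNeighborlyReorientations k ≤ maxNeighborlyReorientations M.rank n k :=
  le_csSup (bddAbove_numNeighborlyReorientations M.rank n k) ⟨M, hM, rfl, rfl⟩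

/-- The bound
`F(r, n, k) = 2 ((n - r) + C(r, k + 1) + 2 ^ (r - 1)) ^ (r - 1 - 2 k) / (r - 1 - 2 k)!`,
meant for `2 k + 2 ≤ r ≤ n`. -/
noncomputable def boundF (r n k : ℕ) : ℝ :=
  2 * (((n : ℝ) - (r : ℝ)) + (Nat.choose r (k + 1) : ℝ) + 2 ^ (r - 1)) ^ (r - 1 - 2 * k)
    / (Nat.factorial (r - 1 - 2 * k) : ℝ)

end OrientedMatroid

/-!
Deleting an element `e` keeps the dependencies that vanish at `e`; contracting it keeps them all and
forgets their value at `e`. A set `R` avoiding `e` such that `R` or `R ∪ {e}` is a `k`-neighborly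
reorientation is one of the deletion, and if both are, then `R` is one of the contraction. So the
number of `k`-neighborly reorientations is at most the sum of those of deletion and contraction, and
`F` satisfies the opposite inequality by Bernoulli's inequality.

The recursion stops when `n = r`, where there are only `2 ^ n` sets, and in rank `2 k + 1`. There
any `2 k + 2` elements support a dependency, which each `k`-neighborly reorientation splits into
`k + 1` positive and `k + 1` negative elements. If `n = 2 k + 2`, this leaves at most
`C(2 k + 2, k + 1)` reorientations. In general, two of them differ in an even number of elements of
every `(2 k + 2)`-subset of the ground set; if `n ≥ 2 k + 3`, they are equal or complementary, so
that there are at most two.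
-/

namespace OrientedMatroid

open Finset
open scoped Nat symmDiff

section OrderedField

variable {K : Type*} [Field K] [LinearOrder K] [IsStrictOrderedRing K] {x y : K}

theorem le_pow_div_factorial {m : ℕ} (hm : 1 ≤ m) (hmx : (m : K) ≤ x) : x ≤ x ^ m / m ! := by
  induction m, hm using Nat.le_induction with
  | base => simp
  | succ m hm ih =>
    have hx : 0 ≤ x := (Nat.cast_nonneg _).trans hmx
    have hmx' : (m : K) ≤ x := (Nat.cast_le.2 m.le_succ).trans hmx
    calc x ≤ x ^ m / m ! := ih hmx'
      _ ≤ x ^ m / m ! * (x / (m + 1 : ℕ)) :=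
        le_mul_of_one_le_right (by positivity) ((one_le_div (by positivity)).2 hmx)
      _ = x ^ (m + 1) / (m + 1)! := by
        rw [Nat.factorial_succ]
        push_cast
        field_simp
        rw [pow_succ]

theorem pow_succ_div_factorial_add_pow_div_factorial_le (hy : 0 ≤ y) (hyx : y ≤ x) (m : ℕ) :
    x ^ (m + 1) / (m + 1)! + y ^ m / m ! ≤ (x + 1) ^ (m + 1) / (m + 1)! := by
  have hx : 0 ≤ x := hy.trans hyx
  have hfactorial : y ^ m / m ! = (m + 1 : ℕ) * y ^ m / (m + 1)! := by
    rw [Nat.factorial_succ]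
    push_cast
    field_simp
  rw [hfactorial, ← add_div]
  gcongr
  calc x ^ (m + 1) + (m + 1 : ℕ) * y ^ m ≤ x ^ (m + 1) + (m + 1 : ℕ) * x ^ m := by gcongr
    _ ≤ (x + 1) ^ (m + 1) := by
      simpa using pow_add_mul_le_add_pow hx (by linarith : 0 ≤ 2 * x + 1) (m + 1)

end OrderedField

section Bound

variable {r n k : ℕ}

theorem boundF_two_mul_add_one (n k : ℕ) : boundF (2 * k + 1) n k = 2 := by
  simp [boundF]

theorem boundF_nonneg (hn : r ≤ n) (k : ℕ) : 0 ≤ boundF r n k := by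
  have : (0 : ℝ) ≤ n - r := sub_nonneg.2 (Nat.cast_le.2 hn)
  unfold boundF
  positivity

theorem two_pow_le_boundF (hr : 2 * k + 2 ≤ r) : (2 : ℝ) ^ r ≤ boundF r r k := by
  set x : ℝ := r.choose (k + 1) + 2 ^ (r - 1) with hx
  have hpow : (2 : ℝ) ^ (r - 1) ≤ x := le_add_of_nonneg_left (Nat.cast_nonneg _)
  have hexp : ((r - 1 - 2 * k : ℕ) : ℝ) ≤ 2 ^ (r - 1) := by
    exact_mod_cast (Nat.sub_le _ _).trans Nat.lt_two_pow_self.le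
  calc (2 : ℝ) ^ r = 2 * 2 ^ (r - 1) := by rw [← pow_succ', Nat.sub_add_cancel (by omega)]
    _ ≤ 2 * x := by gcongr
    _ ≤ 2 * (x ^ (r - 1 - 2 * k) / (r - 1 - 2 * k)!) := by
      gcongr
      exact le_pow_div_factorial (by omega) (hexp.trans hpow)
    _ = boundF r r k := by rw [boundF, sub_self, zero_add, ← hx, mul_div_assoc]

theorem two_pow_add_choose_le_boundF (k : ℕ) :
    (2 : ℝ) ^ (2 * k + 2) + (2 * k + 2).choose (k + 1) ≤ boundF (2 * k + 2) (2 * k + 3) k := by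
  have hexp : 2 * k + 2 - 1 - 2 * k = 1 := by omega
  have hchoose : (0 : ℝ) ≤ (2 * k + 2).choose (k + 1) := Nat.cast_nonneg _
  have hboundF : boundF (2 * k + 2) (2 * k + 3) k =
      2 * (1 + (2 * k + 2).choose (k + 1) + 2 ^ (2 * k + 1)) := by
    rw [boundF, hexp]
    push_cast
    simp only [pow_one, Nat.factorial_one]
    ring
  rw [hboundF, pow_succ']
  linarith [hchoose]

theorem boundF_add_boundF_le (hr : 2 * k + 1 ≤ r) (hn : r ≤ n) :
    boundF (r + 1) n k + boundF r n k ≤ boundF (r + 1) (n + 1) k := by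
  set x : ℝ := n - (r + 1 : ℕ) + (r + 1).choose (k + 1) + 2 ^ r with hx
  set y : ℝ := n - r + r.choose (k + 1) + 2 ^ (r - 1) with hy
  have hn' : (r : ℝ) ≤ n := Nat.cast_le.2 hn
  have hy0 : 0 ≤ y := by
    have : (0 : ℝ) ≤ n - r := sub_nonneg.2 hn'
    positivity
  have hyx : y ≤ x := by
    have hchoose : (r.choose (k + 1) : ℝ) ≤ (r + 1).choose (k + 1) :=
      Nat.cast_le.2 (Nat.choose_le_succ _ _)
    have hpow : (2 : ℝ) ^ r = 2 * 2 ^ (r - 1) := by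
      rw [← pow_succ', Nat.sub_add_cancel (by omega)]
    have hpow_one : (1 : ℝ) ≤ 2 ^ (r - 1) := one_le_pow₀ one_le_two
    rw [hx, hy, Nat.cast_succ]
    linarith
  have hx1 : ((n + 1 : ℕ) : ℝ) - (r + 1 : ℕ) + (r + 1).choose (k + 1) + 2 ^ r = x + 1 := by
    rw [hx, Nat.cast_succ n]
    ring
  have hexp : r - 2 * k = r - 1 - 2 * k + 1 := by omega
  rw [boundF, boundF, boundF, Nat.add_sub_cancel, hexp, hx1, ← hx, ← hy, mul_div_assoc,
    mul_div_assoc, mul_div_assoc, ← mul_add]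
  exact mul_le_mul_of_nonneg_left
    (pow_succ_div_factorial_add_pow_div_factorial_le hy0 hyx (r - 1 - 2 * k)) zero_le_two

end Bound

section Parity

variable {α : Type*} [DecidableEq α]

theorem even_card_symmDiff_of_card_eq {P Q : Finset α} (h : #P = #Q) : Even #(P ∆ Q) := by
  rw [symmDiff_def, sup_eq_union, card_union_of_disjoint disjoint_sdiff_sdiff, card_sdiff_comm h]
  exact Even.add_self _

theorem eq_empty_or_eq_of_forall_even_card_inter {A D : Finset α} {m : ℕ} (hDA : D ⊆ A)
    (hm : m < #A) (hm0 : m ≠ 0) (h : ∀ S ⊆ A, #S = m → Even #(S ∩ D)) : D = ∅ ∨ D = A := by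
  by_contra! hD
  obtain ⟨a, haD⟩ := hD.1
  obtain ⟨b, hbA, hbD⟩ := exists_of_ssubset (hDA.ssubset_of_ne hD.2)
  have haA := hDA haD
  have hab : a ≠ b := fun hab => hbD (hab ▸ haD)
  -- Exchanging `a` for `b` in an `m`-set changes the parity of its intersection with `D`.
  obtain ⟨T, hT, hTcard⟩ : ∃ T ⊆ (A.erase a).erase b, #T = m - 1 := by
    refine exists_subset_card_eq ?_
    rw [card_erase_of_mem (mem_erase.2 ⟨hab.symm, hbA⟩), card_erase_of_mem haA]
    omega
  have hTA : T ⊆ A := hT.trans ((erase_subset _ _).trans (erase_subset _ _))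
  have haT : a ∉ T := fun ha => notMem_erase a A (mem_of_mem_erase (hT ha))
  have hbT : b ∉ T := fun hb => notMem_erase b _ (hT hb)
  have hcard {c : α} (hcT : c ∉ T) : #(insert c T) = m := by
    rw [card_insert_of_notMem hcT, hTcard, Nat.sub_add_cancel (Nat.pos_of_ne_zero hm0)]
  have heven_a := h _ (insert_subset haA hTA) (hcard haT)
  have heven_b := h _ (insert_subset hbA hTA) (hcard hbT)
  rw [insert_inter_of_mem haD, card_insert_of_notMem (by simp [haT]), Nat.even_add_one] at heven_a
  rw [insert_inter_of_notMem hbD] at heven_b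
  exact heven_a heven_b

end Parity

section SignVectors

theorem forall_signType_ne_zero_iff {p : SignType → Prop} :
    (∀ s ≠ 0, p s) ↔ p 1 ∧ p (-1) := by
  refine ⟨fun h => ⟨h 1 (by decide), h (-1) (by decide)⟩, ?_⟩
  rintro ⟨hpos, hneg⟩ (_ | _ | _) hs
  · exact absurd rfl hs
  · exact hneg
  · exact hpos

variable {α : Type*}

theorem card_filter_eq_zero_add_one_add_neg_one (S : Finset α) (X : α → SignType) :
    #{e ∈ S | X e = 0} + #{e ∈ S | X e = 1} + #{e ∈ S | X e = -1} = #S := by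
  have hsum : #S = ∑ s, #{e ∈ S | X e = s} :=
    card_eq_sum_card_fiberwise fun _ _ => mem_coe.2 (mem_univ _)
  rw [hsum, SignType.univ_eq, sum_insert (by decide), sum_pair (by decide)]
  omega

variable [DecidableEq α] {S R R' : Finset α} {X : α → SignType} {e : α}

theorem signFlip_apply_congr (h : e ∈ R ↔ e ∈ R') : signFlip R X e = signFlip R' X e := by
  simp only [signFlip, h]

theorem signFlip_insert_self (he : e ∉ R) : signFlip (insert e R) X e = -signFlip R X e := by
  simp [signFlip, he]

theorem card_filter_signFlip_le_card_filter_erase {A : Finset α} {s : SignType}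
    (hRR' : ∀ f ≠ e, f ∈ R ↔ f ∈ R') (he : signFlip R X e ≠ s) :
    #{f ∈ A | signFlip R X f = s} ≤ #{f ∈ A.erase e | signFlip R' X f = s} := by
  refine card_le_card fun f hf => ?_
  obtain ⟨hfA, hfs⟩ := mem_filter.1 hf
  have hfe : f ≠ e := by
    rintro rfl
    exact he hfs
  exact mem_filter.2 ⟨mem_erase.2 ⟨hfe, hfA⟩, (signFlip_apply_congr (hRR' f hfe)).symm.trans hfs⟩

theorem mem_symmDiff_iff_not_signFlip_eq_one_iff (hX : X e ≠ 0) :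
    e ∈ R ∆ R' ↔ ¬(signFlip R X e = 1 ↔ signFlip R' X e = 1) := by
  revert hX
  simp only [mem_symmDiff, signFlip]
  generalize X e = s
  by_cases h : e ∈ R <;> by_cases h' : e ∈ R' <;> simp only [h, h', if_true, if_false] <;>
    revert s <;> decide

theorem symmDiff_filter_signFlip_eq_one (hX : ∀ e ∈ S, X e ≠ 0) (R R' : Finset α) :
    {e ∈ S | signFlip R X e = 1} ∆ {e ∈ S | signFlip R' X e = 1} = S ∩ R ∆ R' := by
  ext e
  rw [mem_inter, mem_symmDiff, mem_filter, mem_filter]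
  by_cases he : e ∈ S
  · rw [mem_symmDiff_iff_not_signFlip_eq_one_iff (hX e he)]
    tauto
  · simp only [he, false_and, not_false_eq_true, and_true, or_self]

end SignVectors

section Rank

variable {α : Type*}

/-- The minor on `A` whose dependencies are the restrictions to `A` of the sign vectors in `V` has
rank at most `r`: every subset of `A` with `r + 1` elements contains the support of one of them. -/
def RankLE (A : Finset α) (V : Set (α → SignType)) (r : ℕ) : Prop :=
  ∀ S ⊆ A, #S = r + 1 → ∃ X ∈ V, ∀ e ∈ A, X e ≠ 0 → e ∈ S

theorem rankLE_circuits [Fintype α] (M : OrientedMatroid α) :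
    RankLE univ M.circuits M.rank := by
  intro S _ hS
  have hdep : ¬M.Indep S := fun hindep => by
    have := M.isGreatest_rank.2 ⟨S, hindep, rfl⟩
    omega
  simp only [Indep, not_forall, not_not] at hdep
  obtain ⟨X, hX, hXS⟩ := hdep
  exact ⟨X, hX, fun e he hXe => hXS (mem_filter.2 ⟨he, hXe⟩)⟩

theorem rank_le_card [Fintype α] (M : OrientedMatroid α) : M.rank ≤ Fintype.card α := by
  obtain ⟨S, -, hS⟩ := M.isGreatest_rank.1
  exact hS ▸ card_le_univ S

variable [DecidableEq α] {r : ℕ} {A : Finset α} {V : Set (α → SignType)} {e : α}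

theorem RankLE.deletion (h : RankLE A V r) (he : e ∈ A) :
    RankLE (A.erase e) {X ∈ V | X e = 0} r := by
  intro S hS hcard
  obtain ⟨X, hX, hXS⟩ := h S (hS.trans (erase_subset e A)) hcard
  have heS : e ∉ S := fun heS => notMem_erase e A (hS heS)
  exact ⟨X, ⟨hX, not_not.1 fun hXe => heS (hXS e he hXe)⟩,
    fun f hf => hXS f (mem_of_mem_erase hf)⟩

theorem RankLE.contraction (h : RankLE A V (r + 1)) (he : e ∈ A) : RankLE (A.erase e) V r := by
  intro S hS hcard
  have heS : e ∉ S := fun heS => notMem_erase e A (hS heS)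
  obtain ⟨X, hX, hXS⟩ := h (insert e S) (insert_subset he (hS.trans (erase_subset e A)))
    (by rw [card_insert_of_notMem heS, hcard])
  exact ⟨X, hX, fun f hf hXf =>
    mem_of_mem_insert_of_ne (hXS f (mem_of_mem_erase hf) hXf) (ne_of_mem_erase hf)⟩

end Rank

section NeighborlySets

variable {α : Type*} [DecidableEq α] {k r : ℕ} {A S R R' : Finset α} {V : Set (α → SignType)}
  {X : α → SignType} {e : α}

/-- The sets `R ⊆ A` such that every sign vector in `V`, restricted to `A` and with the signs on `R`
reversed, has more than `k` positive and more than `k` negative entries: the `k`-neighborly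
reorientations of the minor on `A` whose dependencies are the restrictions to `A` of the vectors in
`V`. These restrictions need not be minimal, so an element is contracted by just removing it from
`A`. -/
noncomputable def neighborlySets (k : ℕ) (A : Finset α) (V : Set (α → SignType)) :
    Finset (Finset α) :=
  open Classical in
  {R ∈ A.powerset | ∀ X ∈ V, ∀ s ≠ 0, k < #{e ∈ A | signFlip R X e = s}}

theorem mem_neighborlySets :
    R ∈ neighborlySets k A V ↔
      R ⊆ A ∧ ∀ X ∈ V, ∀ s ≠ 0, k < #{e ∈ A | signFlip R X e = s} := by
  classical
  simp only [neighborlySets, mem_filter, mem_powerset]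

theorem numNeighborlyReorientations_eq_card [Fintype α] (M : OrientedMatroid α) (k : ℕ) :
    M.numNeighborlyReorientations k = #(neighborlySets k univ M.circuits) := by
  rw [numNeighborlyReorientations, ← Set.ncard_coe_finset]
  congr 1
  ext R
  simp [mem_neighborlySets, IsNeighborly, reorient, posSet, negSet, forall_signType_ne_zero_iff,
    -ne_eq]

theorem card_neighborlySets_le_two_pow (k : ℕ) (A : Finset α) (V : Set (α → SignType)) :
    #(neighborlySets k A V) ≤ 2 ^ #A := by
  classical
  rw [← card_powerset]
  exact card_filter_le _ _

theorem erase_mem_neighborlySets_deletion (hR : R ∈ neighborlySets k A V) :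
    R.erase e ∈ neighborlySets k (A.erase e) {X ∈ V | X e = 0} := by
  obtain ⟨hRA, hRV⟩ := mem_neighborlySets.1 hR
  refine mem_neighborlySets.2 ⟨erase_subset_erase e hRA, fun X hX s hs => ?_⟩
  have hXe : signFlip R X e = 0 := not_not.1 fun h => (signFlip_apply_ne_zero R X e).1 h hX.2
  exact (hRV X hX.1 s hs).trans_le <| card_filter_signFlip_le_card_filter_erase
    (fun f hf => by simp [hf]) (hXe.trans_ne hs.symm)

theorem mem_neighborlySets_contraction (he : e ∉ R) (hR : R ∈ neighborlySets k A V)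
    (hR' : insert e R ∈ neighborlySets k A V) : R ∈ neighborlySets k (A.erase e) V := by
  obtain ⟨hRA, hRV⟩ := mem_neighborlySets.1 hR
  obtain ⟨-, hRV'⟩ := mem_neighborlySets.1 hR'
  refine mem_neighborlySets.2 ⟨subset_erase.2 ⟨hRA, he⟩, fun X hX s hs => ?_⟩
  -- At least one of the two reorientations gives `X e` a sign other than `s`.
  by_cases hXe : signFlip R X e = s
  · have hXe' : signFlip (insert e R) X e ≠ s := by
      rw [signFlip_insert_self he, hXe, ne_eq, SignType.neg_eq_self_iff]
      exact hs
    exact (hRV' X hX s hs).trans_le <| card_filter_signFlip_le_card_filter_erase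
      (fun f hf => by simp [hf]) hXe'
  · exact (hRV X hX s hs).trans_le <| card_filter_signFlip_le_card_filter_erase
      (fun _ _ => Iff.rfl) hXe

theorem card_neighborlySets_le_deletion_add_contraction (k : ℕ) (A : Finset α)
    (V : Set (α → SignType)) (e : α) :
    #(neighborlySets k A V) ≤
      #(neighborlySets k (A.erase e) {X ∈ V | X e = 0}) + #(neighborlySets k (A.erase e) V) := by
  rw [← card_memberSubfamily_add_card_nonMemberSubfamily e, ← card_union_add_card_inter,
    memberSubfamily_union_nonMemberSubfamily]
  refine add_le_add (card_le_card ?_) (card_le_card fun R hR => ?_)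
  · exact image_subset_iff.2 fun R hR => erase_mem_neighborlySets_deletion hR
  · simp only [mem_inter, mem_memberSubfamily, mem_nonMemberSubfamily] at hR
    exact mem_neighborlySets_contraction hR.1.2 hR.2.1 hR.1.1

theorem ne_zero_and_card_filter_signFlip_eq_one (hR : R ∈ neighborlySets k A V) (hX : X ∈ V)
    (hXS : ∀ e ∈ A, X e ≠ 0 → e ∈ S) (hS : #S = 2 * k + 2) :
    (∀ e ∈ S, X e ≠ 0) ∧ #{e ∈ S | signFlip R X e = 1} = k + 1 := by
  have hlt : ∀ s ≠ 0, k < #{e ∈ S | signFlip R X e = s} := fun s hs => by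
    refine ((mem_neighborlySets.1 hR).2 X hX s hs).trans_le (card_le_card fun e he => ?_)
    obtain ⟨heA, hes⟩ := mem_filter.1 he
    exact mem_filter.2 ⟨hXS e heA ((signFlip_apply_ne_zero R X e).1 (hes.trans_ne hs)), hes⟩
  have hpos := hlt 1 (by decide)
  have hneg := hlt (-1) (by decide)
  have hsum := card_filter_eq_zero_add_one_add_neg_one S (signFlip R X)
  have hzero : #{e ∈ S | signFlip R X e = 0} = 0 := by omega
  refine ⟨fun e he => (signFlip_apply_ne_zero R X e).1 ?_, by omega⟩
  exact filter_eq_empty_iff.1 (card_eq_zero.1 hzero) he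

theorem card_neighborlySets_le_choose (h : RankLE A V (2 * k + 1)) (hA : #A = 2 * k + 2) :
    #(neighborlySets k A V) ≤ (2 * k + 2).choose (k + 1) := by
  obtain ⟨X, hX, hXA⟩ := h A Subset.rfl hA
  rw [← hA, ← card_powersetCard]
  refine card_le_card_of_injOn (fun R => {e ∈ A | signFlip R X e = 1}) (fun R hR => ?_) ?_
  · exact mem_coe.2 <| mem_powersetCard.2
      ⟨filter_subset _ _, (ne_zero_and_card_filter_signFlip_eq_one hR hX hXA hA).2⟩
  · intro R hR R' hR' hRR'
    have hX0 := (ne_zero_and_card_filter_signFlip_eq_one hR hX hXA hA).1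
    have hsub : R ∆ R' ⊆ A := symmDiff_subset_union.trans <|
      union_subset (mem_neighborlySets.1 hR).1 (mem_neighborlySets.1 hR').1
    rw [← symmDiff_eq_bot, ← inter_eq_right.2 hsub, ← symmDiff_filter_signFlip_eq_one hX0,
      symmDiff_eq_bot]
    exact hRR'

theorem card_neighborlySets_le_two_pow_add_choose (h : RankLE A V (2 * k + 2))
    (hA : #A = 2 * k + 3) :
    #(neighborlySets k A V) ≤ 2 ^ (2 * k + 2) + (2 * k + 2).choose (k + 1) := by
  obtain ⟨e, he⟩ : A.Nonempty := card_pos.1 (by omega)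
  have hAe : #(A.erase e) = 2 * k + 2 := (card_erase_of_mem he).trans (by rw [hA]; rfl)
  refine (card_neighborlySets_le_deletion_add_contraction k A V e).trans (add_le_add ?_ ?_)
  · exact hAe ▸ card_neighborlySets_le_two_pow k (A.erase e) _
  · exact card_neighborlySets_le_choose (h.contraction he) hAe

theorem even_card_inter_symmDiff (h : RankLE A V (2 * k + 1)) (hR : R ∈ neighborlySets k A V)
    (hR' : R' ∈ neighborlySets k A V) (hSA : S ⊆ A) (hS : #S = 2 * k + 2) :
    Even #(S ∩ R ∆ R') := by
  obtain ⟨X, hX, hXS⟩ := h S hSA hS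
  obtain ⟨hX0, hcard⟩ := ne_zero_and_card_filter_signFlip_eq_one hR hX hXS hS
  obtain ⟨-, hcard'⟩ := ne_zero_and_card_filter_signFlip_eq_one hR' hX hXS hS
  rw [← symmDiff_filter_signFlip_eq_one hX0]
  exact even_card_symmDiff_of_card_eq (hcard.trans hcard'.symm)

theorem card_neighborlySets_le_two (h : RankLE A V (2 * k + 1)) (hA : 2 * k + 3 ≤ #A) :
    #(neighborlySets k A V) ≤ 2 := by
  rcases (neighborlySets k A V).eq_empty_or_nonempty with hempty | ⟨R, hR⟩
  · simp [hempty]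
  refine (card_le_card (t := {R, R ∆ A}) fun R' hR' => ?_).trans card_le_two
  have hsub : R ∆ R' ⊆ A := symmDiff_subset_union.trans <|
    union_subset (mem_neighborlySets.1 hR).1 (mem_neighborlySets.1 hR').1
  have hdiff : R ∆ R' = ∅ ∨ R ∆ R' = A := eq_empty_or_eq_of_forall_even_card_inter hsub hA
    (by omega) fun S hSA hS => even_card_inter_symmDiff h hR hR' hSA hS
  rw [mem_insert, mem_singleton, ← symmDiff_symmDiff_cancel_left R R']
  rcases hdiff with hdiff | hdiff <;> simp [hdiff]

theorem card_neighborlySets_le_boundF (h : RankLE A V r) (hr : 2 * k + 2 ≤ r) (hA : r ≤ #A) :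
    (#(neighborlySets k A V) : ℝ) ≤ boundF r #A k := by
  induction hn : #A generalizing A V r with
  | zero => omega
  | succ n ih =>
    rcases hA.eq_or_lt with rfl | hrA
    · rw [← hn]
      exact (Nat.cast_le.2 (card_neighborlySets_le_two_pow k A V)).trans
        (by simpa using two_pow_le_boundF hr)
    obtain ⟨r, rfl⟩ : ∃ s, r = s + 1 := Nat.exists_eq_add_one.2 (by omega)
    by_cases hbase : r = 2 * k + 1 ∧ n = 2 * k + 2
    · obtain ⟨rfl, rfl⟩ := hbase
      exact (Nat.cast_le.2 (card_neighborlySets_le_two_pow_add_choose h hn)).trans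
        (by simpa using two_pow_add_choose_le_boundF k)
    obtain ⟨e, he⟩ : A.Nonempty := card_pos.1 (by omega)
    have hAe : #(A.erase e) = n := by rw [card_erase_of_mem he, hn, Nat.add_sub_cancel]
    have hdeletion : (#(neighborlySets k (A.erase e) {X ∈ V | X e = 0}) : ℝ) ≤
        boundF (r + 1) n k := ih (h.deletion he) hr (by omega) hAe
    have hcontraction : (#(neighborlySets k (A.erase e) V) : ℝ) ≤ boundF r n k := by
      rcases (show 2 * k + 1 ≤ r by omega).eq_or_lt with rfl | hr'
      · rw [boundF_two_mul_add_one]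
        exact_mod_cast card_neighborlySets_le_two (h.contraction he) (by omega)
      · exact ih (h.contraction he) hr' (by omega) hAe
    calc (#(neighborlySets k A V) : ℝ)
        ≤ #(neighborlySets k (A.erase e) {X ∈ V | X e = 0}) + #(neighborlySets k (A.erase e) V) :=
          mod_cast card_neighborlySets_le_deletion_add_contraction k A V e
      _ ≤ boundF (r + 1) n k + boundF r n k := add_le_add hdeletion hcontraction
      _ ≤ boundF (r + 1) (n + 1) k := boundF_add_boundF_le (by omega) (by omega)

end NeighborlySets

theorem maxNeighborlyReorientations_le {r n k : ℕ} {b : ℝ} (hb : 0 ≤ b)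
    (h : ∀ M : OrientedMatroid (Fin n), M.IsSimple → M.rank = r →
      (M.numNeighborlyReorientations k : ℝ) ≤ b) :
    (maxNeighborlyReorientations r n k : ℝ) ≤ b := by
  rw [← Nat.le_floor_iff hb]
  refine csSup_le' ?_
  rintro _ ⟨M, hM, hrank, rfl⟩
  exact (Nat.le_floor_iff hb).2 (h M hM hrank)

end OrientedMatroid

theorem theorem3_general {E : Type*} [Fintype E] [DecidableEq E] (M : OrientedMatroid E) {k : ℕ}
    (hr : 2 * k + 2 ≤ M.rank) :
    (M.numNeighborlyReorientations k : ℝ) ≤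
      OrientedMatroid.boundF M.rank (Fintype.card E) k := by
  rw [M.numNeighborlyReorientations_eq_card]
  exact OrientedMatroid.card_neighborlySets_le_boundF M.rankLE_circuits hr M.rank_le_card

theorem theorem3 (r n k : ℕ) (hk : 4 ≤ 2 * k + 2) (hr : 2 * k + 2 ≤ r) (hn : r + 1 ≤ n) :
    (OrientedMatroid.maxNeighborlyReorientations r n k : ℝ) ≤ OrientedMatroid.boundF r n k := by
  refine OrientedMatroid.maxNeighborlyReorientations_le (OrientedMatroid.boundF_nonneg (by omega) k)
    fun M _ hrank => ?_
  simpa [hrank] using theorem3_general M (hrank.symm ▸ hr)
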